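/- Let $N, M$ be natural numbers and let $\mathcal S$ be the set of the $K = N\cdot M$ encryption methods (pairs of one of $N$ techniques and one of its $M$ keys). In the moving target defense (MTD) game, $\mathcal S$ is both the state set and the defender's action set, and the attacker's action set is $\mathcal A_2=\{1,\dots,N\}$, the set of techniques. At each time $t = 1,2,\dots$ both players, knowing the past, choose actions $a^1_t \in \mathcal S$ and $a^2_t\in\mathcal A_2$ at the current state $s_t$, and the next state is $s_{t+1}=a^1_t$. Let $n_t$ be the number of consecutive method changes immediately before time $t$: $n_1=0$, $n_{t+1}=n_t+1$ if $s_{t+1}\neq s_t$, and $n_{t+1}=0$ otherwise (so $n_t\le t-1$). With arbitrary real-valued reward and power functions $R_1,T_1,P_1,R_2,P_2$, a real cost value $q$ and the linear MTD cost $C(q,n)=q\cdot n$, the utilities at time $t$ are $$U_1 = R_1(a^2_t)+T_1(a^1_t,a^2_t,s_t)-P_1(s_t)-q\,n_t,\qquad U_2 = R_2(a^1_t,a^2_t,s_t)-P_2(s_t),$$ and the accumulated utilities are $\Phi_i=\sum_{t\ge 1}\beta^{t-1}U_i$ with $0<\beta<1$ (with $U_i$ replaced by its expectation if the strategies are randomized).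 Then: 1. The series $\Phi_1$ converges and is bounded, by a constant that depends only on the game: uniformly over all plays (sequences of states and attacker's actions), and uniformly over all initial states and all pairs of (randomized, possibly history-dependent) strategies. Over strategies the same holds for $\Phi_2$. 2. Hence the game still admits an equilibrium point: - the bimatrix game whose rows and columns are the pure stationary strategies $f:\mathcal S\to\mathcal S$ and $g:\mathcal S\to\mathcal A_2$, with defender's payoffs $X_{f,g}=\sum_{s\in\mathcal S}\Phi_1(f,g,s)$ (where $\Phi_1(f,g,s)$ is the accumulated utility from the initial state $s$) and attacker's payoffs $Y_{f,g}=\sum_{s\in\mathcal S}U_2(f(s),g(s),s)$ (the attacker's utility evaluated at the first time step only), has a mixed Nash equilibrium; - the stochastic game has a Nash equilibrium $(E^*,H^*)$ in stationary mixed strategies, i.e. the action probabilities depend only on the current $(s_t,n_t)$, the data on which the utilities depend: from every initial state $s\in\mathcal S$ (with $n_1=0$), $\Phi_1(\hat E,H^*,s)\le\Phi_1(E^*,H^*,s)$ and $\Phi_2(E^*,\hat H,s)\le\Phi_2(E^*,H^*,s)$ for all strategies $\hat E$, $\hat H$, including history-dependent ones. -/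

import Mathlib

/-- An encryption method: a technique together with one of its keys. The methods are both the
states of the game and the actions of the defender. -/
abbrev Method (N M : ℕ) : Type := Fin N × Fin M

/-- The data of the moving target defense game with `N` techniques and `M` keys per technique.
In `T₁` and `R₂` the arguments are: defender's action, attacker's action, current state. -/
structure MTDGame (N M : ℕ) where
  R₁ : Fin N → ℝ
  T₁ : Method N M → Fin N → Method N M → ℝ
  P₁ : Method N M → ℝ
  R₂ : Method N M → Fin N → Method N M → ℝ
  P₂ : Method N M → ℝ
  /-- discount factor -/
  β : ℝ
  /-- cost value -/
  q : ℝ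

/-- The linear cost of `n` consecutive method changes. -/
def linearCost (q : ℝ) (n : ℕ) : ℝ := q * n

namespace MTDGame

noncomputable section

variable {N M : ℕ} (G : MTDGame N M)

/-- Defender's utility at state `s` after `n` consecutive method changes, cost included. -/
def U₁ (a : Method N M) (b : Fin N) (s : Method N M) (n : ℕ) : ℝ :=
  G.R₁ b + G.T₁ a b s - G.P₁ s - linearCost G.q n

/-- Attacker's utility at state `s`. -/
def U₂ (a : Method N M) (b : Fin N) (s : Method N M) : ℝ :=
  G.R₂ a b s - G.P₂ s

/-! ### Plays and pure stationary strategies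

Time is indexed from `0`, so `β ^ t` here is the weight of the `(t+1)`-st step. -/

/-- The number of consecutive method changes immediately before time `t`, along the sequence
`ω` of states: the counter is `0` at the start, grows by one at each change of method and
returns to `0` whenever the method is kept. -/
def changes (ω : ℕ → Method N M) : ℕ → ℕ
  | 0 => 0
  | t + 1 => if ω (t + 1) = ω t then 0 else changes ω t + 1

/-- Discounted utility of the defender at time `t` along the play with states `ω` and attacker's
actions `b`. The defender's action at time `t` is the next state `ω (t + 1)`. -/
def playTerm₁ (ω : ℕ → Method N M) (b : ℕ → Fin N) (t : ℕ) : ℝ :=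
  G.β ^ t * G.U₁ (ω (t + 1)) (b t) (ω t) (changes ω t)

/-- Accumulated utility of the defender along a play. -/
def playUtility₁ (ω : ℕ → Method N M) (b : ℕ → Fin N) : ℝ :=
  ∑' t, G.playTerm₁ ω b t

/-- Accumulated utility of the defender from the initial state `s` under the pure stationary
strategies `f` and `g`; the state at time `t` is then `f^[t] s`. -/
def purePhi₁ (f : Method N M → Method N M) (g : Method N M → Fin N) (s : Method N M) : ℝ :=
  G.playUtility₁ (fun t => f^[t] s) (fun t => g (f^[t] s))

/-- Defender's matrix of the bimatrix game over pure stationary strategies. -/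
def X : Matrix (Method N M → Method N M) (Method N M → Fin N) ℝ :=
  fun f g => ∑ s, G.purePhi₁ f g s

/-- Attacker's matrix of the bimatrix game: the attacker's utility is evaluated at the first
time step only. -/
def Y : Matrix (Method N M → Method N M) (Method N M → Fin N) ℝ :=
  fun f g => ∑ s, G.U₂ (f s) (g s) s

/-! ### Randomized strategies -/

/-- A finite history: the initial state and the list of past action pairs, latest first. -/
abbrev History (N M : ℕ) : Type := Method N M × List (Method N M × Fin N)

/-- The current state and the current number of consecutive changes after the past actions `h`
from the initial state `s`. -/
def config (s : Method N M) : List (Method N M × Fin N) → Method N M × ℕ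
  | [] => (s, 0)
  | (a, _) :: h => (a, if a = (config s h).1 then 0 else (config s h).2 + 1)

/-- A behavioral strategy with action set `A`: a probability distribution on `A` after each
history. -/
abbrev Strategy (N M : ℕ) (A : Type) [Fintype A] : Type := History N M → stdSimplex ℝ A

/-- A stationary strategy: the distribution depends only on the current state and the current
number of consecutive changes. -/
abbrev StationaryStrategy (N M : ℕ) (A : Type) [Fintype A] : Type :=
  Method N M × ℕ → stdSimplex ℝ A

/-- A stationary strategy as a strategy. -/
def StationaryStrategy.toStrategy {A : Type} [Fintype A] (e : StationaryStrategy N M A) :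
    Strategy N M A :=
  fun h => e (config h.1 h.2)

/-- Expected value of the step utility `u` (arguments: defender's action, attacker's action,
state, number of consecutive changes) `t` steps after the past actions `h` from the initial
state `s`, when the players use `σ` and `τ`. -/
def expectedStep (u : Method N M → Fin N → Method N M → ℕ → ℝ)
    (σ : Strategy N M (Method N M)) (τ : Strategy N M (Fin N)) (s : Method N M) :
    ℕ → List (Method N M × Fin N) → ℝ
  | 0, h => ∑ a, ∑ b, (σ (s, h)).1 a * (τ (s, h)).1 b * u a b (config s h).1 (config s h).2
  | t + 1, h => ∑ a, ∑ b, (σ (s, h)).1 a * (τ (s, h)).1 b *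
      expectedStep u σ τ s t ((a, b) :: h)

/-- Discounted expected utility of the defender at time `t`, from the initial state `s`. -/
def term₁ (σ : Strategy N M (Method N M)) (τ : Strategy N M (Fin N)) (s : Method N M)
    (t : ℕ) : ℝ :=
  G.β ^ t * expectedStep G.U₁ σ τ s t []

/-- Discounted expected utility of the attacker at time `t`, from the initial state `s`. -/
def term₂ (σ : Strategy N M (Method N M)) (τ : Strategy N M (Fin N)) (s : Method N M)
    (t : ℕ) : ℝ :=
  G.β ^ t * expectedStep (fun a b s _ => G.U₂ a b s) σ τ s t []

/-- Accumulated expected utility of the defender. -/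
def Phi₁ (σ : Strategy N M (Method N M)) (τ : Strategy N M (Fin N)) (s : Method N M) : ℝ :=
  ∑' t, G.term₁ σ τ s t

/-- Accumulated expected utility of the attacker. -/
def Phi₂ (σ : Strategy N M (Method N M)) (τ : Strategy N M (Fin N)) (s : Method N M) : ℝ :=
  ∑' t, G.term₂ σ τ s t

/-- Nash equilibrium of the stochastic game: from no initial state can a player gain by changing
only its own strategy, to any strategy whatsoever. -/
def IsEquilibrium (σ : Strategy N M (Method N M)) (τ : Strategy N M (Fin N)) : Prop :=
  ∀ s, (∀ σ', G.Phi₁ σ' τ s ≤ G.Phi₁ σ τ s) ∧ (∀ τ', G.Phi₂ σ τ' s ≤ G.Phi₂ σ τ s)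

end

end MTDGame

open scoped Matrix in
/-- Mixed Nash equilibrium of the bimatrix game `(X, Y)`. -/
def IsBimatrixEquilibrium {I J : Type} [Fintype I] [Fintype J] (X Y : Matrix I J ℝ)
    (x : I → ℝ) (y : J → ℝ) : Prop :=
  x ∈ stdSimplex ℝ I ∧ y ∈ stdSimplex ℝ J ∧
    (∀ x' ∈ stdSimplex ℝ I, x' ⬝ᵥ (X *ᵥ y) ≤ x ⬝ᵥ (X *ᵥ y)) ∧
    (∀ y' ∈ stdSimplex ℝ J, x ⬝ᵥ (Y *ᵥ y') ≤ x ⬝ᵥ (Y *ᵥ y))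

/-! The counter grows by at most one per step, so the utility at time `t` is at most `R + |q| t` in
absolute value, and the weights `β ^ t` beat linear growth; this gives all the bounds. The bimatrix
game is finite, so Nash's theorem applies to it.

In the stochastic game the configurations `(s, n)` are infinite in number and the costs unbounded,
but two facts help. The attacker does not influence the transitions, so against a stationary
defender it is optimal to maximize the immediate expected utility at each configuration. And the
defender's value update preserves the bounds `|v (s, n)| ≤ S + K n` for suitable `S` and `K`. Mixed
actions and values thus range over a product of compact intervals, on which Nash's improvement map
and the value update, after retraction to the simplices, form a continuous self-map
(`exists_isAdmissible_fixedPoint`). A fixed point satisfies the defender's optimality equation and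
is myopically optimal for the attacker; expansion over finite horizons, with remainder `O(t β ^ t)`,
shows that no strategy does better (`isEquilibrium_of_optimal`).

The fixed point comes from Brouwer's theorem: Scarf's parity argument gives approximate fixed points
on a simplex, compactness exact ones, finite cubes reduce to simplices, and the finite intersection
property covers infinitely many coordinates. -/

/-! ### Scarf's combinatorial lemma -/

namespace Scarf

open Finset

variable {I X α : Type*} [LinearOrder α]

/-- A finite set `Z` is dominant for the rankings `rk i` of `X` if no element of `X` lies strictly
above the minimum of `Z` in all rankings at once. -/
def IsDominant (rk : I → X → α) (Z : Finset X) : Prop :=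
  ∀ y, ∃ i, ∀ z ∈ Z, rk i y ≤ rk i z

/-- `m i` is a minimal element of `W` in the ranking `i`, for each `i`. -/
def IsMinMap (rk : I → X → α) (W : Finset X) (m : I → X) : Prop :=
  ∀ i, m i ∈ W ∧ ∀ w ∈ W, rk i (m i) ≤ rk i w

/-- The elements strictly above `m i` in all rankings `i` other than `j`. -/
def beyond (rk : I → X → α) (m : I → X) (j : I) : Set X :=
  {y | ∀ i, i ≠ j → rk i (m i) < rk i y}

/-- Slack elements `s i`: each is the least element of its own ranking, and in the other rankings
it lies above all elements that are not slack. -/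
structure IsSlack (rk : I → X → α) (s : I → X) : Prop where
  lt_of_ne : ∀ i x, x ≠ s i → rk i (s i) < rk i x
  lt_slack : ∀ i j x, i ≠ j → (∀ k, x ≠ s k) → rk i x < rk i (s j)
  injective : Function.Injective s

variable {rk : I → X → α} {W Z : Finset X} {m : I → X}

lemma IsDominant.mono (hZ : IsDominant rk Z) (h : W ⊆ Z) : IsDominant rk W := fun y =>
  (hZ y).imp fun _ hi z hz => hi z (h hz)

lemma exists_isMinMap (rk : I → X → α) (hW : W.Nonempty) : ∃ m, IsMinMap rk W m := by
  choose m hm using fun i => exists_min_image W (rk i) hW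
  exact ⟨m, hm⟩

/-- Dominance tested on `w` itself yields a ranking in which `w` is the minimum. Hence a dominant
set has at most as many elements as there are rankings. -/
lemma IsMinMap.surjOn (hrk : ∀ i, Function.Injective (rk i)) (hm : IsMinMap rk W m)
    (hW : IsDominant rk W) {w : X} (hw : w ∈ W) : ∃ i, m i = w := by
  obtain ⟨i, hi⟩ := hW w
  exact ⟨i, hrk i (le_antisymm ((hm i).2 w hw) (hi _ (hm i).1))⟩

lemma IsDominant.insert [DecidableEq X] (hW : IsDominant rk W) (hm : IsMinMap rk W m) {j : I}
    {y : X} (hy : y ∈ beyond rk m j) (hmax : ∀ y' ∈ beyond rk m j, rk j y' ≤ rk j y) :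
    IsDominant rk (insert y W) := by
  intro y'
  by_cases h : y' ∈ beyond rk m j
  · obtain ⟨i, hi⟩ := hW y'
    have hij : i = j := by
      by_contra hij
      exact absurd (hi _ (hm i).1) (not_le.2 (h i hij))
    subst hij
    refine ⟨i, fun z hz => ?_⟩
    rcases mem_insert.1 hz with rfl | hz
    · exact hmax _ h
    · exact hi z hz
  · simp only [beyond, Set.mem_ofPred_eq, not_forall, not_lt] at h
    obtain ⟨i, hij, hi⟩ := h
    refine ⟨i, fun z hz => ?_⟩
    rcases mem_insert.1 hz with rfl | hz
    · exact hi.trans (hy i hij).le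
    · exact hi.trans ((hm i).2 z hz)

/-- In a dominant set of full size the minimum map is a bijection, so `y` is the minimum in exactly
one ranking `i`, and removing it changes only the `i`-th minimum. -/
lemma exists_beyond_of_insert [Fintype I] [DecidableEq X] (hrk : ∀ i, Function.Injective (rk i))
    (hm : IsMinMap rk W m) {y : X} (hyW : y ∉ W) (hcard : W.card + 1 = Fintype.card I)
    (hZ : IsDominant rk (insert y W)) :
    ∃ i, y ∈ beyond rk m i ∧ (∀ y' ∈ beyond rk m i, rk i y' ≤ rk i y) ∧
      ∀ j k, j ≠ i → k ≠ i → m j = m k → j = k := by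
  obtain ⟨m', hm'⟩ := exists_isMinMap rk (insert_nonempty y W)
  have himg : univ.image m' = insert y W := by
    ext w
    simp only [mem_image, mem_univ, true_and]
    constructor
    · rintro ⟨i, rfl⟩
      exact (hm' i).1
    · exact fun hw => hm'.surjOn hrk hZ hw
  have hinj : Function.Injective m' := by
    have : (univ.image m').card = (univ : Finset I).card := by
      rw [himg, card_insert_of_notMem hyW, hcard, card_univ]
    exact fun a b hab => card_image_iff.1 this (by simp) (by simp) hab
  obtain ⟨i, hi⟩ := hm'.surjOn hrk hZ (mem_insert_self y W)
  have hne : ∀ j, j ≠ i → m' j = m j := by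
    intro j hj
    have hj' : m' j ∈ W := by
      rcases mem_insert.1 (hm' j).1 with h | h
      · exact absurd (hinj (h.trans hi.symm)) hj
      · exact h
    exact hrk j (le_antisymm ((hm' j).2 _ (mem_insert_of_mem (hm j).1)) ((hm j).2 _ hj'))
  refine ⟨i, fun j hj => ?_, fun y' hy' => ?_, fun j k hj hk h => ?_⟩
  · refine lt_of_le_of_ne ?_ fun h => hyW ?_
    · rw [← hne j hj]
      exact (hm' j).2 _ (mem_insert_self y W)
    · rw [← hrk j h]
      exact (hm j).1
  · obtain ⟨l, hl⟩ := hZ y'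
    by_cases hli : l = i
    · subst hli
      exact hl _ (mem_insert_self y W)
    · exact absurd (hl _ (mem_insert_of_mem (hm l).1)) (not_le.2 (hy' l hli))
  · exact hinj ((hne j hj).trans (h.trans (hne k hk).symm))

lemma exists_collision [Fintype I] (hm : IsMinMap rk W m)
    (hcard : W.card + 1 = Fintype.card I) : ∃ j k, j ≠ k ∧ m j = m k := by
  obtain ⟨j, -, k, -, hjk, h⟩ := exists_ne_map_eq_of_card_lt_of_maps_to
    (s := (univ : Finset I)) (t := W) (f := m) (by rw [card_univ]; omega) (fun i _ => (hm i).1)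
  exact ⟨j, k, hjk, h⟩

lemma notMem_of_mem_beyond (hrk : ∀ i, Function.Injective (rk i)) (hm : IsMinMap rk W m)
    (hW : IsDominant rk W) {j k : I} (hjk : j ≠ k) (h : m j = m k) {y : X}
    (hy : y ∈ beyond rk m j) : y ∉ W := by
  intro hyW
  obtain ⟨i, rfl⟩ := hm.surjOn hrk hW hyW
  by_cases hi : i = j
  · subst hi
    have := hy k hjk.symm
    rw [h] at this
    exact lt_irrefl _ this
  · exact lt_irrefl _ (hy i hi)

lemma exists_isMax_beyond [Finite X] {j : I} (h : (beyond rk m j).Nonempty) :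
    ∃ y ∈ beyond rk m j, ∀ y' ∈ beyond rk m j, rk j y' ≤ rk j y :=
  Set.exists_max_image _ (rk j) (Set.toFinite _) h

variable [Fintype I]

open Classical in
lemma isDominant_slack {s : I → X} (hs : IsSlack rk s) (i₀ : I) :
    IsDominant rk ((univ.erase i₀).image s) := by
  intro y
  by_cases hy : ∃ k, y = s k
  · obtain ⟨k, rfl⟩ := hy
    refine ⟨k, fun z _ => ?_⟩
    by_cases hz : z = s k
    · rw [hz]
    · exact (hs.lt_of_ne k z hz).le
  · push Not at hy
    refine ⟨i₀, fun z hz => ?_⟩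
    obtain ⟨j, hj, rfl⟩ := mem_image.1 hz
    exact (hs.lt_slack i₀ j y (ne_of_mem_erase hj).symm hy).le

open Classical in
lemma card_image_slack {s : I → X} (hs : IsSlack rk s) (i₀ : I) :
    ((univ.erase i₀).image s).card + 1 = Fintype.card I := by
  rw [card_image_of_injective _ hs.injective, card_erase_add_one (mem_univ _), card_univ]

/-! ### Rooms, doors and the parity argument -/

variable [Fintype X]

open Classical in
/-- The dominant sets of full size. -/
noncomputable def rooms (rk : I → X → α) : Finset (Finset X) :=
  univ.filter fun Z => IsDominant rk Z ∧ Z.card = Fintype.card I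

lemma mem_rooms : Z ∈ rooms rk ↔ IsDominant rk Z ∧ Z.card = Fintype.card I := by
  simp [rooms]

open Classical in
-- Only one of the two indices with a common minimum can receive the new element, which leaves at
-- most two rooms around `W`.
lemma exists_of_mem_rooms (hrk : ∀ i, Function.Injective (rk i)) (hm : IsMinMap rk W m)
    (hcard : W.card + 1 = Fintype.card I) {j k : I} (hjk : j ≠ k) (h : m j = m k)
    (hZ : Z ∈ rooms rk) (hWZ : W ⊆ Z) :
    ∃ i, (i = j ∨ i = k) ∧ ∃ y ∈ beyond rk m i, (∀ y' ∈ beyond rk m i, rk i y' ≤ rk i y) ∧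
      Z = insert y W := by
  rw [mem_rooms] at hZ
  obtain ⟨y, hyW, rfl⟩ := exists_eq_insert_iff.2 ⟨hWZ, hcard.trans hZ.2.symm⟩
  obtain ⟨i, hi, hmax, hinj⟩ := exists_beyond_of_insert hrk hm hyW hcard hZ.1
  refine ⟨i, ?_, y, hi, hmax, rfl⟩
  by_contra hne
  push Not at hne
  exact hjk (hinj j k hne.1.symm hne.2.symm h)

open Classical in
lemma insert_mem_rooms (hrk : ∀ i, Function.Injective (rk i)) (hm : IsMinMap rk W m)
    (hW : IsDominant rk W) (hcard : W.card + 1 = Fintype.card I) {j k : I} (hjk : j ≠ k)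
    (h : m j = m k) {y : X} (hy : y ∈ beyond rk m j)
    (hmax : ∀ y' ∈ beyond rk m j, rk j y' ≤ rk j y) : insert y W ∈ rooms rk := by
  rw [mem_rooms, card_insert_of_notMem (notMem_of_mem_beyond hrk hm hW hjk h hy)]
  exact ⟨hW.insert hm hy hmax, hcard⟩

open Classical in
-- Each of the two colliding indices gives one room: `s j` lies above the non-slack `x` in all
-- rankings but `j`, so no `beyond` set is empty.
lemma card_rooms_of_not_slack {s : I → X} (hrk : ∀ i, Function.Injective (rk i))
    (hs : IsSlack rk s) (hW : IsDominant rk W) (hcard : W.card + 1 = Fintype.card I) {x : X}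
    (hx : x ∈ W) (hxs : ∀ k, x ≠ s k) : ((rooms rk).filter (W ⊆ ·)).card = 2 := by
  obtain ⟨m, hm⟩ := exists_isMinMap rk ⟨x, hx⟩
  obtain ⟨j, k, hjk, h⟩ := exists_collision hm hcard
  have key : ∀ j, (beyond rk m j).Nonempty := fun j =>
    ⟨s j, fun i hij => ((hm i).2 x hx).trans_lt (hs.lt_slack i j x hij hxs)⟩
  obtain ⟨y, hy, hymax⟩ := exists_isMax_beyond (key j)
  obtain ⟨z, hz, hzmax⟩ := exists_isMax_beyond (key k)
  have hyz : y ≠ z := by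
    rintro rfl
    obtain ⟨i, hi⟩ := hW y
    have hi' := hi _ (hm i).1
    by_cases hij : i = j
    · exact absurd hi' (not_le.2 (hz i (hij ▸ hjk)))
    · exact absurd hi' (not_le.2 (hy i hij))
  have hyW := notMem_of_mem_beyond hrk hm hW hjk h hy
  refine card_eq_two.2 ⟨insert y W, insert z W, fun he => ?_, ?_⟩
  · have : y ∈ insert z W := he ▸ mem_insert_self y W
    rcases mem_insert.1 this with h' | h'
    · exact hyz h'
    · exact hyW h'
  · ext Z
    simp only [mem_filter, mem_insert, mem_singleton]
    constructor
    · rintro ⟨hZ, hWZ⟩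
      obtain ⟨i, hi | hi, y', hy', hmax', rfl⟩ := exists_of_mem_rooms hrk hm hcard hjk h hZ hWZ
      · subst hi
        left
        rw [hrk i (le_antisymm (hymax _ hy') (hmax' _ hy))]
      · subst hi
        right
        rw [hrk i (le_antisymm (hzmax _ hy') (hmax' _ hz))]
    · rintro (rfl | rfl)
      · exact ⟨insert_mem_rooms hrk hm hW hcard hjk h hy hymax, subset_insert _ _⟩
      · exact ⟨insert_mem_rooms hrk hm hW hcard hjk.symm h.symm hz hzmax, subset_insert _ _⟩

open Classical in
-- Here `m i = s i` for `i ≠ i₀`, and `m i₀` is some `s k`. Nothing lies beyond `k`: above `s k` in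
-- ranking `i₀` there are only slack elements, and none of them exceeds all the required minima.
-- Only the room through `i₀` remains.
lemma card_rooms_of_slack [Nontrivial I] {s : I → X} (hrk : ∀ i, Function.Injective (rk i))
    (hs : IsSlack rk s) (i₀ : I) :
    ((rooms rk).filter ((univ.erase i₀).image s ⊆ ·)).card = 1 := by
  set W := (univ.erase i₀).image s with hWdef
  have hW : IsDominant rk W := isDominant_slack hs i₀
  have hcard : W.card + 1 = Fintype.card I := card_image_slack hs i₀
  have hmem : ∀ i, i ≠ i₀ → s i ∈ W := fun i hi =>
    mem_image_of_mem _ (mem_erase.2 ⟨hi, mem_univ _⟩)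
  have hne : W.Nonempty := by
    obtain ⟨i, hi⟩ := exists_ne i₀
    exact ⟨_, hmem i hi⟩
  obtain ⟨m, hm⟩ := exists_isMinMap rk hne
  have hms : ∀ i, i ≠ i₀ → m i = s i := by
    intro i hi
    by_contra h
    exact absurd ((hm i).2 _ (hmem i hi)) (not_le.2 (hs.lt_of_ne i _ h))
  obtain ⟨k, hk, hmk⟩ := mem_image.1 (hm i₀).1
  have hk0 : k ≠ i₀ := ne_of_mem_erase hk
  have h : m i₀ = m k := by rw [← hmk, hms k hk0]
  have hempty : ∀ y, y ∉ beyond rk m k := by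
    intro y hy
    have h0 := hy i₀ hk0.symm
    rw [← hmk] at h0
    by_cases hys : ∃ l, y = s l
    · obtain ⟨l, rfl⟩ := hys
      by_cases hl0 : l = i₀
      · subst hl0
        exact lt_asymm h0 (hs.lt_of_ne l _ fun e => hk0 (hs.injective e))
      · by_cases hlk : l = k
        · subst hlk
          exact lt_irrefl _ h0
        · have := hy l hlk
          rw [hms l hl0] at this
          exact lt_irrefl _ this
    · push Not at hys
      exact lt_asymm h0 (hs.lt_slack i₀ k y hk0.symm hys)
  have hnonempty : (beyond rk m i₀).Nonempty := by
    refine ⟨s i₀, fun i hi => ?_⟩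
    rw [hms i hi]
    exact hs.lt_of_ne i _ fun e => hi (hs.injective e).symm
  obtain ⟨y, hy, hymax⟩ := exists_isMax_beyond hnonempty
  refine card_eq_one.2 ⟨insert y W, ?_⟩
  ext Z
  simp only [mem_filter, mem_singleton]
  constructor
  · rintro ⟨hZ, hWZ⟩
    obtain ⟨i, hi | hi, y', hy', hmax', rfl⟩ :=
      exists_of_mem_rooms hrk hm hcard hk0.symm h hZ hWZ
    · subst hi
      rw [hrk i (le_antisymm (hymax _ hy') (hmax' _ hy))]
    · subst hi
      exact absurd hy' (hempty y')
  · rintro rfl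
    exact ⟨insert_mem_rooms hrk hm hW hcard hk0.symm h hy hymax, subset_insert _ _⟩

open Classical in
/-- The dominant sets with one element missing, carrying all colours but `i₀`. -/
noncomputable def doors (rk : I → X → α) (c : X → I) (i₀ : I) : Finset (Finset X) :=
  univ.filter fun W =>
    IsDominant rk W ∧ W.card + 1 = Fintype.card I ∧ W.image c = univ.erase i₀

open Classical in
lemma mem_doors {c : X → I} {i₀ : I} : W ∈ doors rk c i₀ ↔
    IsDominant rk W ∧ W.card + 1 = Fintype.card I ∧ W.image c = univ.erase i₀ := by
  simp [doors]

open Classical in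
/-- A room in which some colour is missing has an even number of doors. -/
lemma even_card_doors {c : X → I} {i₀ : I} (hZ : Z ∈ rooms rk) (hc : Z.image c ≠ univ) :
    Even ((doors rk c i₀).filter (· ⊆ Z)).card := by
  rw [mem_rooms] at hZ
  rcases ((doors rk c i₀).filter (· ⊆ Z)).eq_empty_or_nonempty with he | ⟨W, hW⟩
  · simp [he]
  rw [mem_filter, mem_doors] at hW
  obtain ⟨⟨hWd, hWcard, hWc⟩, hWZ⟩ := hW
  have hinj : Set.InjOn c W := by
    apply card_image_iff.1
    rw [hWc, card_erase_of_mem (mem_univ _), card_univ]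
    omega
  obtain ⟨z, hzW, rfl⟩ := exists_eq_insert_iff.2 ⟨hWZ, hWcard.trans hZ.2.symm⟩
  have hcz : c z ≠ i₀ := by
    intro h
    apply hc
    rw [image_insert, hWc, h, insert_erase (mem_univ _)]
  have : c z ∈ W.image c := by
    rw [hWc]
    exact mem_erase.2 ⟨hcz, mem_univ _⟩
  obtain ⟨x, hxW, hxz⟩ := mem_image.1 this
  have hxz' : x ≠ z := fun h => hzW (h ▸ hxW)
  have hzx : z ∉ W.erase x := fun h => hzW (mem_of_mem_erase h)
  -- Only `x` and `z` share a colour, so a door of this room omits exactly one of them.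
  have htwo : (doors rk c i₀).filter (· ⊆ insert z W) = {W, insert z (W.erase x)} := by
    ext V
    simp only [mem_filter, mem_insert, mem_singleton, mem_doors]
    constructor
    · rintro ⟨⟨hVd, hVcard, hVc⟩, hVZ⟩
      have hVinj : Set.InjOn c V := by
        apply card_image_iff.1
        rw [hVc, card_erase_of_mem (mem_univ _), card_univ]
        omega
      by_cases hzV : z ∈ V
      · right
        have hxV : x ∉ V := fun hxV => hxz' (hVinj hxV hzV hxz)
        apply eq_of_subset_of_card_le
        · intro v hv
          rcases mem_insert.1 (hVZ hv) with rfl | hvW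
          · exact mem_insert_self _ _
          · exact mem_insert_of_mem (mem_erase.2 ⟨fun e => hxV (e ▸ hv), hvW⟩)
        · rw [card_insert_of_notMem hzx, card_erase_add_one hxW]
          omega
      · left
        apply eq_of_subset_of_card_le
        · intro v hv
          rcases mem_insert.1 (hVZ hv) with rfl | hvW
          · exact absurd hv hzV
          · exact hvW
        · omega
    · rintro (rfl | rfl)
      · exact ⟨⟨hWd, hWcard, hWc⟩, subset_insert _ _⟩
      · have hsub : insert z (W.erase x) ⊆ insert z W := insert_subset_insert _ (erase_subset _ _)
        refine ⟨⟨hZ.1.mono hsub, ?_, ?_⟩, hsub⟩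
        · rw [card_insert_of_notMem hzx, card_erase_add_one hxW]
          omega
        · rw [← hWc, image_insert, ← hxz, ← image_insert, insert_erase hxW]
  rw [htwo, card_pair]
  · exact even_two
  · intro h
    apply hzW
    rw [h]
    exact mem_insert_self _ _

open Classical in
/-- **Scarf's lemma**: for every colouring in which the slack element `s i` has colour `i`, there
is a dominant set with one element of each colour. -/
theorem exists_colorful_room [Nontrivial I] {s : I → X} (hrk : ∀ i, Function.Injective (rk i))
    (hs : IsSlack rk s) (c : X → I) (hcs : ∀ i, c (s i) = i) :
    ∃ Z, IsDominant rk Z ∧ ∀ i, ∃ z ∈ Z, c z = i := by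
  by_contra hno
  have hno' : ∀ Z ∈ rooms rk, Z.image c ≠ univ := by
    intro Z hZ hc
    refine hno ⟨Z, (mem_rooms.1 hZ).1, fun i => ?_⟩
    have : i ∈ Z.image c := hc ▸ mem_univ i
    simpa using this
  obtain ⟨i₀⟩ : Nonempty I := inferInstance
  -- Double counting of the pairs door ⊆ room. By rooms the total is even, as no room has all
  -- colours; by doors it is odd, since the slack door lies in one room and every other door in two.
  have hcount := sum_card_bipartiteAbove_eq_sum_card_bipartiteBelow (s := doors rk c i₀)
    (t := rooms rk) (fun W Z => W ⊆ Z)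
  have hW₀ : (univ.erase i₀).image s ∈ doors rk c i₀ := by
    rw [mem_doors]
    refine ⟨isDominant_slack hs i₀, card_image_slack hs i₀, ?_⟩
    rw [image_image]
    have : c ∘ s = id := funext hcs
    rw [this, image_id]
  have heven : Even (∑ Z ∈ rooms rk, (bipartiteBelow (fun W Z => W ⊆ Z) (doors rk c i₀) Z).card) :=
    even_sum _ fun Z hZ => even_card_doors hZ (hno' Z hZ)
  rw [← hcount, ← add_sum_erase _ _ hW₀] at heven
  have h1 : (bipartiteAbove (fun W Z => W ⊆ Z) (rooms rk) ((univ.erase i₀).image s)).card = 1 :=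
    card_rooms_of_slack hrk hs i₀
  have h2 : Even (∑ W ∈ (doors rk c i₀).erase ((univ.erase i₀).image s),
      (bipartiteAbove (fun W Z => W ⊆ Z) (rooms rk) W).card) := by
    refine even_sum _ fun W hW => ?_
    rw [mem_erase, mem_doors] at hW
    obtain ⟨hne, hWd, hWcard, hWc⟩ := hW
    -- A door made only of slack elements is, by its colours, the slack door.
    have hx : ∃ x ∈ W, ∀ k, x ≠ s k := by
      by_contra hall
      push Not at hall
      apply hne
      apply eq_of_subset_of_card_le
      · intro x hx
        obtain ⟨k, rfl⟩ := hall x hx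
        refine mem_image_of_mem _ ?_
        rw [← hWc]
        exact mem_image.2 ⟨s k, hx, hcs k⟩
      · have := card_image_slack hs i₀
        omega
    obtain ⟨x, hx, hxs⟩ := hx
    have := card_rooms_of_not_slack hrk hs hWd hWcard hx hxs
    change Even ((rooms rk).filter (W ⊆ ·)).card
    rw [this]
    exact even_two
  rw [h1] at heven
  obtain ⟨a, ha⟩ := heven
  obtain ⟨b, hb⟩ := h2
  omega

end Scarf

/-! ### Brouwer's fixed point theorem -/

namespace Brouwer

open Finset

/-! ### Scarf's lemma on the grid points of a simplex -/

section Grid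

variable {I : Type*} [Fintype I] [DecidableEq I]

/-- The points of the standard simplex with denominator `k`, multiplied by `k`. -/
abbrev Grid (I : Type*) [Fintype I] [DecidableEq I] (k : ℕ) : Type _ :=
  {x : I → ℕ // x ∈ piAntidiag univ k}

lemma Grid.sum_eq {k : ℕ} (x : Grid I k) : ∑ i, x.1 i = k := (mem_piAntidiag.1 x.2).1

lemma Grid.exists_ge [Nonempty I] {k : ℕ} (a : I → ℕ) (ha : ∑ i, a i ≤ k) :
    ∃ y : Grid I k, ∀ i, a i ≤ y.1 i := by
  obtain ⟨i₀⟩ := ‹Nonempty I›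
  refine ⟨⟨a + Pi.single i₀ (k - ∑ i, a i), ?_⟩, fun i => ?_⟩
  · simp [mem_piAntidiag, sum_add_distrib, ha]
  · simp

/-- The rough position of a grid point or slack element in the ranking by coordinate `i`. -/
def key {k : ℕ} (i : I) : Grid I k ⊕ I → ℕ
  -- The shift by one leaves `0` to the slack element of ranking `i`; since `x.1 i ≤ k`, the value
  -- `k + 2` is above all grid points.
  | .inl x => x.1 i + 1
  | .inr j => if j = i then 0 else k + 2

/-- The ranking by coordinate `i`, with ties broken by an enumeration. -/
noncomputable def rank {k : ℕ} (i : I) (z : Grid I k ⊕ I) :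
    ℕ ×ₗ Fin (Fintype.card (Grid I k ⊕ I)) :=
  toLex (key i z, Fintype.equivFin _ z)

lemma rank_injective {k : ℕ} (i : I) : Function.Injective (rank (k := k) i) := by
  intro a b h
  have := congrArg (fun p => (ofLex p).2) h
  simpa [rank] using this

lemma rank_lt_rank {k : ℕ} {i : I} {a b : Grid I k ⊕ I} (h : key i a < key i b) :
    rank i a < rank i b :=
  Prod.Lex.lt_iff.2 (Or.inl h)

lemma key_le_key {k : ℕ} {i : I} {a b : Grid I k ⊕ I} (h : rank i a ≤ rank i b) :
    key i a ≤ key i b := by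
  by_contra hlt
  exact absurd h (not_le.2 (rank_lt_rank (not_le.1 hlt)))

lemma isSlack_rank (k : ℕ) : Scarf.IsSlack (rank (I := I) (k := k)) Sum.inr where
  lt_of_ne i x hx := by
    apply rank_lt_rank
    rcases x with x | j
    · simp [key]
    · have : j ≠ i := fun h => hx (by rw [h])
      simp [key, this]
  lt_slack i j x hij hx := by
    apply rank_lt_rank
    rcases x with x | l
    · have h1 : x.1 i ≤ k :=
        (single_le_sum (fun _ _ => Nat.zero_le _) (mem_univ i)).trans_eq x.sum_eq
      simp only [key, hij.symm, if_false]
      omega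
    · exact absurd rfl (hx l)
  injective := Sum.inr_injective

/-- The elements of a dominant set are close to each other. -/
lemma close_of_isDominant [Nonempty I] {k : ℕ} {Z : Finset (Grid I k ⊕ I)}
    (hZ : Scarf.IsDominant rank Z) {x : Grid I k} (hx : Sum.inl x ∈ Z) :
    (∀ i, Sum.inr i ∈ Z → x.1 i ≤ Fintype.card I) ∧
      ∀ y, Sum.inl y ∈ Z → ∀ i, x.1 i ≤ y.1 i + Fintype.card I := by
  have hmin : ∀ i, ∃ w : Grid I k, Sum.inl w ∈ Z ∧ ∀ y, Sum.inl y ∈ Z → w.1 i ≤ y.1 i := by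
    intro i
    obtain ⟨w, hw, hmin⟩ := exists_min_image (univ.filter fun w : Grid I k => Sum.inl w ∈ Z)
      (fun w => w.1 i) ⟨x, by simpa using hx⟩
    exact ⟨w, by simpa using hw, fun y hy => hmin y (by simpa using hy)⟩
  choose w hwZ hw using hmin
  -- A grid point with all coordinates at least `a` would lie above the minimum of `Z` in every
  -- ranking. So `a` has sum at least `k + 1`, while `a j ≤ x.1 j + 1` and `x` has sum `k`: the
  -- total deficit is at most `card I - 1`.
  let a : I → ℕ := fun i => if Sum.inr i ∈ Z then 0 else (w i).1 i + 1
  have ha : k + 1 ≤ ∑ i, a i := by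
    by_contra hlt
    obtain ⟨y, hy⟩ := Grid.exists_ge (k := k) a (by omega)
    obtain ⟨i, hi⟩ := hZ (Sum.inl y)
    by_cases hiZ : Sum.inr i ∈ Z
    · have := key_le_key (hi _ hiZ)
      simp [key] at this
    · have h1 := key_le_key (hi _ (hwZ i))
      have h2 := hy i
      simp only [key, a, hiZ, if_false] at h1 h2
      omega
  have hax : ∀ y : Grid I k, Sum.inl y ∈ Z → ∀ i, a i ≤ y.1 i + 1 := by
    intro y hy i
    by_cases hiZ : Sum.inr i ∈ Z
    · simp [a, hiZ]
    · simpa [a, hiZ] using hw i y hy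
  have hxa : ∀ i, x.1 i + 1 ≤ a i + (Fintype.card I - 1) := by
    intro i
    have h1 := add_sum_erase univ a (mem_univ i)
    have h2 := add_sum_erase univ x.1 (mem_univ i)
    have h3 : ∑ j ∈ univ.erase i, a j ≤ ∑ j ∈ univ.erase i, (x.1 j + 1) :=
      sum_le_sum fun j _ => hax x hx j
    rw [sum_add_distrib, sum_const, card_erase_of_mem (mem_univ i), card_univ, smul_eq_mul,
      mul_one] at h3
    have h4 := x.sum_eq
    omega
  refine ⟨fun i hi => ?_, fun y hy i => ?_⟩
  · have := hxa i
    simp only [a, hi, if_true] at this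
    omega
  · have h1 := hxa i
    have h2 := hax y hy i
    have h3 := Fintype.card_pos (α := I)
    omega

/-- For every labelling of the grid there is a grid point such that for each `i` either its `i`-th
coordinate is small or a point with label `i` is near. -/
lemma exists_grid_point [Nontrivial I] {k : ℕ} (label : Grid I k → I) :
    ∃ x : Grid I k, ∀ i, x.1 i ≤ Fintype.card I ∨
      ∃ y : Grid I k, label y = i ∧
        ∀ j, x.1 j ≤ y.1 j + Fintype.card I ∧ y.1 j ≤ x.1 j + Fintype.card I := by
  obtain ⟨Z, hZ, hc⟩ := Scarf.exists_colorful_room rank_injective (isSlack_rank k)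
    (Sum.elim label id) (fun _ => rfl)
  -- Otherwise `Z` contains all slack elements, and every grid point lies above `Sum.inr i` in
  -- ranking `i`.
  obtain ⟨x, hx⟩ : ∃ x, Sum.inl x ∈ Z := by
    by_contra hno
    push Not at hno
    obtain ⟨y, -⟩ := Grid.exists_ge (I := I) (k := k) 0 (by simp)
    obtain ⟨i, hi⟩ := hZ (Sum.inl y)
    obtain ⟨z, hz, hzi⟩ := hc i
    rcases z with z | j
    · exact hno z hz
    · have := key_le_key (hi _ hz)
      simp only [Sum.elim_inr, id] at hzi
      simp [key, hzi] at this
  refine ⟨x, fun i => ?_⟩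
  obtain ⟨z, hz, hzi⟩ := hc i
  rcases z with y | j
  · exact Or.inr ⟨y, hzi, fun j =>
      ⟨(close_of_isDominant hZ hx).2 y hz j, (close_of_isDominant hZ hz).2 x hx j⟩⟩
  · simp only [Sum.elim_inr, id] at hzi
    subst hzi
    exact Or.inl ((close_of_isDominant hZ hx).1 j hz)

end Grid

/-! ### From grid points to fixed points -/

section Simplex

variable {I : Type*} [Fintype I]

lemma exists_apply_le {x y : I → ℝ} (hx : x ∈ stdSimplex ℝ I) (hy : y ∈ stdSimplex ℝ I) :
    ∃ i, x i ≤ y i := by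
  by_contra! h
  have hne : (univ : Finset I).Nonempty := by
    rw [univ_nonempty_iff]
    by_contra hI
    rw [not_nonempty_iff] at hI
    simpa using hx.2
  have := sum_lt_sum_of_nonempty hne fun i _ => h i
  rw [hx.2, hy.2] at this
  exact lt_irrefl _ this

lemma eq_of_le {x y : I → ℝ} (hx : x ∈ stdSimplex ℝ I) (hy : y ∈ stdSimplex ℝ I)
    (h : ∀ i, x i ≤ y i) : x = y := by
  have := (sum_eq_sum_iff_of_le fun i (_ : i ∈ univ) => h i).1 (hx.2.trans hy.2.symm)
  exact funext fun i => this i (mem_univ i)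

lemma exists_approx_fixedPoint [Nontrivial I] {f : stdSimplex ℝ I → stdSimplex ℝ I}
    (hf : Continuous f) {ε : ℝ} (hε : 0 < ε) : ∃ x, ∀ i, x.1 i - ε ≤ (f x).1 i := by
  classical
  have hu := CompactSpace.uniformContinuous_of_continuous hf
  obtain ⟨δ, hδ, hfδ⟩ := Metric.uniformContinuous_iff.1 hu (ε / 2) (by positivity)
  set n : ℝ := ((Fintype.card I : ℕ) : ℝ) with hn
  obtain ⟨k, hk⟩ := exists_nat_gt (n / min δ (ε / 2))
  have hmin : 0 < min δ (ε / 2) := lt_min hδ (by positivity)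
  have hk0 : (0 : ℝ) < k := lt_of_le_of_lt (by positivity) hk
  have hnk : n / k < min δ (ε / 2) := by
    rw [div_lt_iff₀ hmin] at hk
    rw [div_lt_iff₀ hk0]
    linarith
  let p : Grid I k → stdSimplex ℝ I := fun x => ⟨fun i => x.1 i / k, fun i => by positivity, by
    rw [← sum_div, ← Nat.cast_sum, x.sum_eq, div_self hk0.ne']⟩
  -- The label of a point is a coordinate that `f` does not decrease.
  choose label hlabel using fun x : Grid I k => exists_apply_le (p x).2 (f (p x)).2
  obtain ⟨x, hx⟩ := exists_grid_point label
  refine ⟨p x, fun i => ?_⟩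
  rcases hx i with h | ⟨y, rfl, hxy⟩
  · have h1 : (p x).1 i ≤ n / k := by
      change (x.1 i : ℝ) / k ≤ n / k
      gcongr
      rw [hn]
      exact_mod_cast h
    have h2 := (f (p x)).2.1 i
    have h3 := min_le_right δ (ε / 2)
    linarith
  · have habs : ∀ j, |(p x).1 j - (p y).1 j| ≤ n / k := by
      intro j
      have h1 : (x.1 j : ℝ) ≤ y.1 j + n := by rw [hn]; exact_mod_cast (hxy j).1
      have h2 : (y.1 j : ℝ) ≤ x.1 j + n := by rw [hn]; exact_mod_cast (hxy j).2
      change |(x.1 j : ℝ) / k - y.1 j / k| ≤ n / k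
      rw [← sub_div, abs_div, abs_of_pos hk0]
      gcongr
      rw [abs_le]
      constructor <;> linarith
    have hd : dist (p x) (p y) < δ := by
      refine lt_of_le_of_lt ?_ (hnk.trans_le (min_le_left _ _))
      rw [Subtype.dist_eq, dist_pi_le_iff (by positivity)]
      exact habs
    have h1 := (dist_le_pi_dist (f (p x)).1 (f (p y)).1 (label y)).trans_lt (hfδ hd)
    rw [Real.dist_eq, abs_lt] at h1
    have h2 := (abs_le.1 (habs (label y))).2
    have h3 := min_le_right δ (ε / 2)
    have h4 := hlabel y
    linarith

/-- **Brouwer's fixed point theorem** for the standard simplex. -/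
theorem exists_fixedPoint_stdSimplex [Nonempty I] {f : stdSimplex ℝ I → stdSimplex ℝ I}
    (hf : Continuous f) : ∃ x, f x = x := by
  rcases subsingleton_or_nontrivial I with hI | hI
  · obtain ⟨x⟩ : Nonempty (stdSimplex ℝ I) := inferInstance
    exact ⟨x, Subsingleton.elim _ _⟩
  -- The maximum of `g` is at least `-ε` for every `ε > 0`, hence nonnegative; where it is attained
  -- `x ≤ f x` coordinatewise, and equal sums force equality.
  let g : stdSimplex ℝ I → ℝ := fun x => univ.inf' univ_nonempty fun i => (f x).1 i - x.1 i
  have hg : Continuous g := by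
    apply Continuous.finset_inf'_apply
    intro i _
    exact ((continuous_apply i).comp (continuous_subtype_val.comp hf)).sub
      ((continuous_apply i).comp continuous_subtype_val)
  obtain ⟨x, -, hx⟩ := isCompact_univ.exists_isMaxOn (Set.univ_nonempty) hg.continuousOn
  have h0 : 0 ≤ g x := by
    refine le_of_forall_pos_le_add fun ε hε => ?_
    obtain ⟨y, hy⟩ := exists_approx_fixedPoint hf hε
    have h1 : -ε ≤ g y := le_inf' _ _ fun i _ => by linarith [hy i]
    have h2 : g y ≤ g x := hx (Set.mem_univ y)
    linarith
  refine ⟨x, Subtype.ext (eq_of_le x.2 (f x).2 fun i => ?_).symm⟩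
  have := h0.trans (inf'_le (fun i => (f x).1 i - x.1 i) (mem_univ i))
  linarith

end Simplex

/-- Brouwer's fixed point theorem for finite-dimensional cubes. -/
theorem exists_fixedPoint_cube_of_fintype {ι : Type*} [Fintype ι]
    {f : (ι → unitInterval) → ι → unitInterval} (hf : Continuous f) : ∃ x, f x = x := by
  rcases isEmpty_or_nonempty ι with hι | hι
  · exact ⟨isEmptyElim, Subsingleton.elim _ _⟩
  set n : ℝ := ((Fintype.card ι : ℕ) : ℝ) with hn
  have hn0 : 0 < n := by rw [hn]; exact_mod_cast Fintype.card_pos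
  -- The cube scaled by `1 / n` fits into the simplex, with the remaining mass on `none`; `clip`
  -- undoes the scaling.
  let clip : stdSimplex ℝ (Option ι) → ι → unitInterval := fun y i =>
    Set.projIcc 0 1 zero_le_one (n * y.1 (some i))
  have hclip : Continuous clip := by
    refine continuous_pi fun i => continuous_projIcc.comp ?_
    exact continuous_const.mul ((continuous_apply (some i)).comp continuous_subtype_val)
  let h : stdSimplex ℝ (Option ι) → Option ι → ℝ := fun y o =>
    o.elim (1 - ∑ i, (f (clip y) i : ℝ) / n) fun i => (f (clip y) i : ℝ) / n
  have hmem : ∀ y, h y ∈ stdSimplex ℝ (Option ι) := by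
    intro y
    constructor
    · rintro (_ | i)
      · have : ∑ i, (f (clip y) i : ℝ) / n ≤ ∑ _i : ι, 1 / n :=
          sum_le_sum fun i _ => by gcongr; exact (f (clip y) i).2.2
        rw [sum_const, card_univ, nsmul_eq_mul, ← hn, mul_one_div_cancel hn0.ne'] at this
        simpa [h] using this
      · exact div_nonneg (f (clip y) i).2.1 hn0.le
    · simp [h, Fintype.sum_option]
  have hh : Continuous h := by
    have h1 : ∀ i, Continuous fun y => ((f (clip y) i : ℝ)) := fun i =>
      continuous_subtype_val.comp ((continuous_apply i).comp (hf.comp hclip))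
    refine continuous_pi fun o => ?_
    rcases o with _ | i
    · exact continuous_const.sub (continuous_finsetSum _ fun i _ => (h1 i).div_const n)
    · exact (h1 i).div_const n
  obtain ⟨y, hy⟩ := exists_fixedPoint_stdSimplex (f := fun y => ⟨h y, hmem y⟩)
    (hh.subtype_mk _)
  refine ⟨clip y, funext fun i => ?_⟩
  have h1 : (f (clip y) i : ℝ) / n = y.1 (some i) := congrFun (congrArg Subtype.val hy) (some i)
  have h2 : n * y.1 (some i) = f (clip y) i := by
    rw [← h1]
    field_simp
  change f (clip y) i = Set.projIcc 0 1 zero_le_one (n * y.1 (some i))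
  rw [h2, Set.projIcc_val]

/-- Brouwer's fixed point theorem for cubes of arbitrary dimension. -/
theorem exists_fixedPoint_cube {ι : Type*} {f : (ι → unitInterval) → ι → unitInterval}
    (hf : Continuous f) : ∃ x, f x = x := by
  classical
  have key : (⋂ i, {x | f x i = x i}).Nonempty := by
    rw [← Set.univ_inter (⋂ i, {x | f x i = x i})]
    refine isCompact_univ.inter_iInter_nonempty _ (fun i => ?_) fun s => ?_
    · exact isClosed_eq ((continuous_apply i).comp hf) (continuous_apply i)
    -- Coordinates outside the finite set `s` are frozen at `0`.
    · let ext : (s → unitInterval) → ι → unitInterval := fun x i =>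
        if h : i ∈ s then x ⟨i, h⟩ else 0
      have hext : Continuous ext := by
        refine continuous_pi fun i => ?_
        by_cases h : i ∈ s
        · simpa [ext, h] using continuous_apply (⟨i, h⟩ : s)
        · simpa [ext, h] using continuous_const
      obtain ⟨x, hx⟩ := exists_fixedPoint_cube_of_fintype
        (f := fun (x : s → unitInterval) (i : s) => f (ext x) i)
        (continuous_pi fun i => (continuous_apply (i : ι)).comp (hf.comp hext))
      refine ⟨ext x, Set.mem_univ _, Set.mem_iInter₂.2 fun i hi => ?_⟩
      have := congrFun hx ⟨i, hi⟩
      change f (ext x) i = ext x i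
      simpa [ext, hi] using this
  obtain ⟨x, hx⟩ := key
  exact ⟨x, funext fun i => Set.mem_iInter.1 hx i⟩

/-- Brouwer's fixed point theorem for boxes of arbitrary dimension. -/
theorem exists_fixedPoint_box {ι : Type*} {a b : ι → ℝ} (hab : ∀ i, a i ≤ b i)
    {f : (ι → ℝ) → ι → ℝ} (hf : Continuous f)
    (hmaps : ∀ x, (∀ i, x i ∈ Set.Icc (a i) (b i)) → ∀ i, f x i ∈ Set.Icc (a i) (b i)) :
    ∃ x, (∀ i, x i ∈ Set.Icc (a i) (b i)) ∧ f x = x := by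
  let p : (ι → unitInterval) → ι → ℝ := fun x i => a i + (b i - a i) * x i
  have hp : Continuous p := by fun_prop
  have hpmem : ∀ x i, p x i ∈ Set.Icc (a i) (b i) := by
    intro x i
    have h1 := (x i).2.1
    have h2 := (x i).2.2
    have h3 := hab i
    constructor
    · have := mul_nonneg (sub_nonneg.2 h3) h1
      simp only [p]
      linarith
    · have := mul_nonneg (sub_nonneg.2 h3) (sub_nonneg.2 h2)
      simp only [p]
      linarith
  -- If `a i = b i` the quotient is `0`, by the convention for division by zero.
  have hmem : ∀ x i, (f (p x) i - a i) / (b i - a i) ∈ unitInterval := by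
    intro x i
    have h := hmaps _ (hpmem x) i
    exact ⟨div_nonneg (sub_nonneg.2 h.1) (sub_nonneg.2 (hab i)),
      div_le_one_of_le₀ (by linarith [h.2]) (sub_nonneg.2 (hab i))⟩
  obtain ⟨x, hx⟩ := exists_fixedPoint_cube
    (f := fun x i => (⟨(f (p x) i - a i) / (b i - a i), hmem x i⟩ : unitInterval))
    (continuous_pi fun i => Continuous.subtype_mk (by fun_prop) _)
  refine ⟨p x, hpmem x, funext fun i => ?_⟩
  have hxi : (f (p x) i - a i) / (b i - a i) = x i := congrArg Subtype.val (congrFun hx i)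
  change f (p x) i = a i + (b i - a i) * x i
  rcases (hab i).eq_or_lt with h | h
  · have := hmaps _ (hpmem x) i
    rw [← h, Set.Icc_self, Set.mem_singleton_iff] at this
    rw [this, ← h]
    ring
  · rw [← hxi, mul_div_cancel₀ _ (sub_pos.2 h).ne']
    ring

end Brouwer

/-! ### Existence of equilibria in families of simplices -/

namespace Equilibrium

open Finset

section Simplex

variable {A : Type*} [Fintype A]

/-- A retraction onto the standard simplex, defined for nonnegative vectors. -/
noncomputable def retract (x : A → ℝ) (a : A) : ℝ :=
  (x a + max (1 - ∑ b, x b) 0 / Fintype.card A) / max 1 (∑ b, x b)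

lemma retract_mem [Nonempty A] {x : A → ℝ} (hx : ∀ a, 0 ≤ x a) : retract x ∈ stdSimplex ℝ A := by
  have hpos : 0 < max 1 (∑ b, x b) := lt_of_lt_of_le one_pos (le_max_left _ _)
  constructor
  · intro a
    exact div_nonneg (add_nonneg (hx a) (div_nonneg (le_max_right _ _) (Nat.cast_nonneg _)))
      hpos.le
  · have hcard : (Fintype.card A : ℝ) ≠ 0 := by
      exact_mod_cast Fintype.card_ne_zero
    simp only [retract]
    rw [← sum_div, sum_add_distrib, sum_const, card_univ, nsmul_eq_mul, mul_div_cancel₀ _ hcard,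
      div_eq_one_iff_eq hpos.ne']
    rcases le_total 1 (∑ b, x b) with h | h
    · rw [max_eq_right h, max_eq_right (by linarith), add_zero]
    · rw [max_eq_left h, max_eq_left (by linarith), add_sub_cancel]

lemma retract_eq_self {x : A → ℝ} (hx : x ∈ stdSimplex ℝ A) : retract x = x := by
  funext a
  simp [retract, hx.2]

lemma continuous_retract : Continuous (retract : (A → ℝ) → A → ℝ) := by
  refine continuous_pi fun a => Continuous.div (by fun_prop) (by fun_prop) fun x => ?_
  have h : 0 < max 1 (∑ b, x b) := lt_of_lt_of_le one_pos (le_max_left _ _)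
  exact h.ne.symm

/-- What the pure action `a` gains over the mixed action `x`, if positive, for the payoffs `p`. -/
noncomputable def gain (x p : A → ℝ) (a : A) : ℝ := max (p a - ∑ b, x b * p b) 0

/-- Nash's map, which moves weight to the actions with a positive gain. -/
noncomputable def improve (x p : A → ℝ) (a : A) : ℝ :=
  (x a + gain x p a) / (1 + ∑ b, gain x p b)

lemma gain_nonneg (x p : A → ℝ) (a : A) : 0 ≤ gain x p a := le_max_right _ _

lemma one_add_sum_gain_pos (x p : A → ℝ) : 0 < 1 + ∑ b, gain x p b :=
  add_pos_of_pos_of_nonneg one_pos (sum_nonneg fun b _ => gain_nonneg x p b)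

lemma improve_mem {x : A → ℝ} (hx : x ∈ stdSimplex ℝ A) (p : A → ℝ) :
    improve x p ∈ stdSimplex ℝ A := by
  constructor
  · exact fun a => div_nonneg (add_nonneg (hx.1 a) (gain_nonneg x p a))
      (one_add_sum_gain_pos x p).le
  · simp only [improve]
    rw [← sum_div, sum_add_distrib, hx.2, div_self (one_add_sum_gain_pos x p).ne']

lemma continuous_improve :
    Continuous fun z : (A → ℝ) × (A → ℝ) => (improve z.1 z.2 : A → ℝ) := by
  have hg : ∀ a, Continuous fun z : (A → ℝ) × (A → ℝ) => gain z.1 z.2 a := by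
    intro a
    unfold gain
    fun_prop
  refine continuous_pi fun a => Continuous.div ?_ ?_ fun z => (one_add_sum_gain_pos _ _).ne'
  · exact (by fun_prop : Continuous fun z : (A → ℝ) × (A → ℝ) => z.1 a).add (hg a)
  · exact continuous_const.add (continuous_finsetSum _ fun b _ => hg b)

/-- At a fixed point each gain is `x b` times the total gain. Since the deviations `p b - m` have
mean zero under `x`, the squared gains sum to zero. -/
lemma le_of_improve_eq_self {x p : A → ℝ} (hx : x ∈ stdSimplex ℝ A) (h : improve x p = x) (a : A) :
    p a ≤ ∑ b, x b * p b := by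
  set m := ∑ b, x b * p b with hm
  have h1 : ∀ b, (∑ b', gain x p b') * x b = gain x p b := by
    intro b
    have := congrFun h b
    rw [improve, div_eq_iff (one_add_sum_gain_pos x p).ne'] at this
    linarith
  have h2 : ∀ b, gain x p b * (p b - m) = gain x p b ^ 2 := by
    intro b
    simp only [gain, ← hm]
    rcases le_total (p b - m) 0 with h | h
    · simp [max_eq_right h]
    · rw [max_eq_left h]
      ring
  have h3 : ∑ b, x b * (p b - m) = 0 := by
    simp only [mul_sub, sum_sub_distrib]
    rw [← sum_mul, hx.2, one_mul, ← hm, sub_self]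
  have h4 : ∑ b, gain x p b ^ 2 = 0 := by
    rw [← mul_zero (∑ b', gain x p b'), ← h3, mul_sum]
    refine sum_congr rfl fun b _ => ?_
    rw [← mul_assoc, h1, h2]
  have h5 := (sum_eq_zero_iff_of_nonneg fun b _ => sq_nonneg (gain x p b)).1 h4 a (mem_univ a)
  have h6 : p a - m ≤ gain x p a := le_max_left _ _
  rw [pow_eq_zero_iff two_ne_zero] at h5
  linarith

end Simplex

/-- At each `c : C` a mixed action of the first player, one of the second player, and a real
value. -/
abbrev Profile (C A B : Type*) : Type _ := (C → A → ℝ) × (C → B → ℝ) × (C → ℝ)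

variable {C A B : Type*} [Fintype A] [Fintype B]

/-- The profiles in which the actions are probability distributions and the values are
bounded by `L`. -/
structure IsAdmissible (L : C → ℝ) (z : Profile C A B) : Prop where
  fst_mem : ∀ c, z.1 c ∈ stdSimplex ℝ A
  snd_mem : ∀ c, z.2.1 c ∈ stdSimplex ℝ B
  abs_le : ∀ c, |z.2.2 c| ≤ L c

/-- If the payoffs `p`, `r` and the update `T` of the values are continuous functions of the
profile, some profile has values fixed by `T` and, at every `c`, mutually optimal actions. -/
theorem exists_isAdmissible_fixedPoint [Nonempty A] [Nonempty B] {L : C → ℝ} (hL : ∀ c, 0 ≤ L c)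
    {p : Profile C A B → C → A → ℝ} (hp : Continuous p)
    {r : Profile C A B → C → B → ℝ} (hr : Continuous r)
    {T : Profile C A B → C → ℝ} (hT : Continuous T)
    (hTL : ∀ z, IsAdmissible L z → ∀ c, |T z c| ≤ L c) :
    ∃ z : Profile C A B, IsAdmissible L z ∧ (∀ c, z.2.2 c = T z c) ∧
      (∀ c a, p z c a ≤ ∑ a', z.1 c a' * p z c a') ∧
      ∀ c b, r z c b ≤ ∑ b', z.2.1 c b' * r z c b' := by
  let J := (C × A) ⊕ (C × B) ⊕ C
  let dec : (J → ℝ) → Profile C A B := fun w =>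
    (fun c => retract fun a => w (.inl (c, a)), fun c => retract fun b => w (.inr (.inl (c, b))),
      fun c => w (.inr (.inr c)))
  have hdec : Continuous dec := by
    refine Continuous.prodMk ?_ (Continuous.prodMk ?_ (by fun_prop))
    · exact continuous_pi fun c => continuous_retract.comp (by fun_prop)
    · exact continuous_pi fun c => continuous_retract.comp (by fun_prop)
  -- The retraction in `dec` makes `F` act on the whole box. The action coordinates of `F w` lie in
  -- the simplices for `w` in the box, so at a fixed point the retraction changes nothing.
  let F : (J → ℝ) → J → ℝ := fun w =>
    Sum.elim (fun i => improve ((dec w).1 i.1) (p (dec w) i.1) i.2)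
      (Sum.elim (fun i => improve ((dec w).2.1 i.1) (r (dec w) i.1) i.2) (T (dec w)))
  have hF : Continuous F := by
    refine continuous_pi fun j => ?_
    rcases j with ⟨c, a⟩ | ⟨c, b⟩ | c
    · exact (continuous_apply a).comp (continuous_improve.comp
        (((continuous_apply c).comp (continuous_fst.comp hdec)).prodMk
          ((continuous_apply c).comp (hp.comp hdec))))
    · exact (continuous_apply b).comp (continuous_improve.comp
        (((continuous_apply c).comp (continuous_fst.comp (continuous_snd.comp hdec))).prodMk
          ((continuous_apply c).comp (hr.comp hdec))))
    · exact (continuous_apply c).comp (hT.comp hdec)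
  let lo : J → ℝ := Sum.elim 0 (Sum.elim 0 (-L))
  let hi : J → ℝ := Sum.elim 1 (Sum.elim 1 L)
  have hadm : ∀ w : J → ℝ, (∀ j, w j ∈ Set.Icc (lo j) (hi j)) → IsAdmissible L (dec w) := by
    intro w hw
    refine ⟨fun c => retract_mem fun a => (hw (.inl (c, a))).1,
      fun c => retract_mem fun b => (hw (.inr (.inl (c, b)))).1, fun c => ?_⟩
    exact abs_le.2 (hw (.inr (.inr c)))
  obtain ⟨w, hw, hfix⟩ := Brouwer.exists_fixedPoint_box (a := lo) (b := hi) (f := F)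
    (by
      rintro (i | i | c)
      · exact zero_le_one
      · exact zero_le_one
      · exact neg_le_self (hL c))
    hF
    (by
      intro w hw
      have hz := hadm w hw
      rintro (i | i | c)
      · exact mem_Icc_of_mem_stdSimplex (improve_mem (hz.fst_mem i.1) _) i.2
      · exact mem_Icc_of_mem_stdSimplex (improve_mem (hz.snd_mem i.1) _) i.2
      · exact abs_le.1 (hTL _ hz c))
  have hz := hadm w hw
  have h1 : ∀ c, improve ((dec w).1 c) (p (dec w) c) = (dec w).1 c := by
    intro c
    have he : (fun a => w (.inl (c, a))) = improve ((dec w).1 c) (p (dec w) c) :=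
      funext fun a => (congrFun hfix (.inl (c, a))).symm
    have : (dec w).1 c = retract fun a => w (.inl (c, a)) := rfl
    rw [he, retract_eq_self (improve_mem (hz.fst_mem c) _)] at this
    exact this.symm
  have h2 : ∀ c, improve ((dec w).2.1 c) (r (dec w) c) = (dec w).2.1 c := by
    intro c
    have he : (fun b => w (.inr (.inl (c, b)))) = improve ((dec w).2.1 c) (r (dec w) c) :=
      funext fun b => (congrFun hfix (.inr (.inl (c, b)))).symm
    have : (dec w).2.1 c = retract fun b => w (.inr (.inl (c, b))) := rfl
    rw [he, retract_eq_self (improve_mem (hz.snd_mem c) _)] at this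
    exact this.symm
  exact ⟨dec w, hz, fun c => (congrFun hfix (.inr (.inr c))).symm,
    fun c => le_of_improve_eq_self (hz.fst_mem c) (h1 c),
    fun c => le_of_improve_eq_self (hz.snd_mem c) (h2 c)⟩

open scoped Matrix in
/-- **Nash's theorem** for bimatrix games. -/
theorem exists_isBimatrixEquilibrium {I J : Type} [Fintype I] [Fintype J] [Nonempty I] [Nonempty J]
    (X Y : Matrix I J ℝ) : ∃ x y, IsBimatrixEquilibrium X Y x y := by
  -- One configuration, with its value held at `0`: only the two improvement maps remain.
  obtain ⟨z, hz, -, hx, hy⟩ := exists_isAdmissible_fixedPoint (C := Unit) (A := I) (B := J)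
    (L := 0) (fun _ => le_rfl) (p := fun z c => X *ᵥ z.2.1 c) (r := fun z c => z.1 c ᵥ* Y)
    (T := fun _ => 0)
    (by unfold Matrix.mulVec dotProduct; fun_prop)
    (by unfold Matrix.vecMul dotProduct; fun_prop)
    (by fun_prop) (by simp)
  have key : ∀ {A : Type} [Fintype A] {w p : A → ℝ} {m : ℝ}, w ∈ stdSimplex ℝ A →
      (∀ a, p a ≤ m) → w ⬝ᵥ p ≤ m := by
    intro A _ w p m hw hp
    calc w ⬝ᵥ p ≤ ∑ a, w a * m := sum_le_sum fun a _ => mul_le_mul_of_nonneg_left (hp a) (hw.1 a)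
      _ = m := by rw [← sum_mul, hw.2, one_mul]
  refine ⟨z.1 (), z.2.1 (), hz.fst_mem (), hz.snd_mem (), fun x' hx' => key hx' (hx ()),
    fun y' hy' => ?_⟩
  rw [Matrix.dotProduct_mulVec, Matrix.dotProduct_mulVec, dotProduct_comm,
    dotProduct_comm (z.1 () ᵥ* Y)]
  exact key hy' (hy ())

end Equilibrium

/-! ### The moving target defense game -/

namespace MTDGame

open Finset Filter Topology

variable {N M : ℕ}

section Average

variable {A B : Type*} [Fintype A] [Fintype B] {x : A → ℝ} {y : B → ℝ}

lemma sum_mul_le_of_le (hx : x ∈ stdSimplex ℝ A) {g : A → ℝ} {m : ℝ} (h : ∀ a, g a ≤ m) :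
    ∑ a, x a * g a ≤ m :=
  calc ∑ a, x a * g a ≤ ∑ a, x a * m :=
        sum_le_sum fun a _ => mul_le_mul_of_nonneg_left (h a) (hx.1 a)
    _ = m := by rw [← sum_mul, hx.2, one_mul]

lemma sum_sum_mul_mul (g : A → B → ℝ) :
    ∑ a, ∑ b, x a * y b * g a b = ∑ a, x a * ∑ b, y b * g a b := by
  simp only [mul_sum, mul_assoc]

lemma sum_sum_le_sum_sum (hx : x ∈ stdSimplex ℝ A) (hy : y ∈ stdSimplex ℝ B) {g g' : A → B → ℝ}
    (h : ∀ a b, g a b ≤ g' a b) :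
    ∑ a, ∑ b, x a * y b * g a b ≤ ∑ a, ∑ b, x a * y b * g' a b :=
  sum_le_sum fun a _ => sum_le_sum fun b _ =>
    mul_le_mul_of_nonneg_left (h a b) (mul_nonneg (hx.1 a) (hy.1 b))

lemma sum_sum_of_const_right (hy : y ∈ stdSimplex ℝ B) (g : A → ℝ) :
    ∑ a, ∑ b, x a * y b * g a = ∑ a, x a * g a := by
  rw [sum_sum_mul_mul]
  simp only [← sum_mul, hy.2, one_mul]

lemma abs_sum_mul_le_of_abs_le (hx : x ∈ stdSimplex ℝ A) {g : A → ℝ} {m : ℝ}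
    (h : ∀ a, |g a| ≤ m) : |∑ a, x a * g a| ≤ m := by
  refine (abs_sum_le_sum_abs _ _).trans (le_trans (sum_le_sum fun a _ => ?_)
    (sum_mul_le_of_le hx h))
  rw [abs_mul, abs_of_nonneg (hx.1 a)]

lemma abs_sum_sum_le_of_abs_le (hx : x ∈ stdSimplex ℝ A) (hy : y ∈ stdSimplex ℝ B)
    {g : A → B → ℝ} {m : ℝ} (h : ∀ a b, |g a b| ≤ m) :
    |∑ a, ∑ b, x a * y b * g a b| ≤ m := by
  rw [sum_sum_mul_mul]
  exact abs_sum_mul_le_of_abs_le hx fun a => abs_sum_mul_le_of_abs_le hy (h a)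

end Average

/-- The configuration reached from `c` by the defender's action `a`. -/
def nextConfig (a : Method N M) (c : Method N M × ℕ) : Method N M × ℕ :=
  (a, if a = c.1 then 0 else c.2 + 1)

lemma nextConfig_snd_le (a : Method N M) (c : Method N M × ℕ) : (nextConfig a c).2 ≤ c.2 + 1 := by
  unfold nextConfig
  split_ifs <;> simp

lemma config_cons (s a : Method N M) (b : Fin N) (h : List (Method N M × Fin N)) :
    config s ((a, b) :: h) = nextConfig a (config s h) := rfl

lemma changes_le (ω : ℕ → Method N M) (t : ℕ) : changes ω t ≤ t := by
  induction t with
  | zero => exact le_rfl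
  | succ t ih =>
    rw [changes]
    split_ifs <;> omega

lemma abs_expectedStep_le {u : Method N M → Fin N → Method N M → ℕ → ℝ} {R K : ℝ} (hK : 0 ≤ K)
    (hu : ∀ a b s n, |u a b s n| ≤ R + K * n) (σ : Strategy N M (Method N M))
    (τ : Strategy N M (Fin N)) (s : Method N M) (t : ℕ) (h : List (Method N M × Fin N)) :
    |expectedStep u σ τ s t h| ≤ R + K * ((config s h).2 + t) := by
  induction t generalizing h with
  | zero =>
    rw [expectedStep]
    refine abs_sum_sum_le_of_abs_le (σ (s, h)).2 (τ (s, h)).2 fun a b => (hu _ _ _ _).trans ?_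
    simp
  | succ t ih =>
    rw [expectedStep]
    refine abs_sum_sum_le_of_abs_le (σ (s, h)).2 (τ (s, h)).2 fun a b => (ih _).trans ?_
    have h1 : ((config s ((a, b) :: h)).2 : ℝ) ≤ (config s h).2 + 1 := by
      exact_mod_cast nextConfig_snd_le a (config s h)
    have h2 := mul_le_mul_of_nonneg_left h1 hK
    push_cast
    linarith

lemma summable_pow_mul_linear {β : ℝ} (hβ0 : 0 < β) (hβ1 : β < 1) (R K : ℝ) :
    Summable fun t : ℕ => β ^ t * (R + K * t) := by
  have h1 := (summable_geometric_of_lt_one hβ0.le hβ1).mul_left R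
  have h2 : Summable fun t : ℕ => (t : ℝ) ^ 1 * β ^ t :=
    summable_pow_mul_geometric_of_norm_lt_one 1 (by rwa [Real.norm_of_nonneg hβ0.le])
  refine (h1.add (h2.mul_left K)).congr fun t => ?_
  ring

lemma summable_and_abs_tsum_le {β : ℝ} (hβ0 : 0 < β) (hβ1 : β < 1) {R K : ℝ} {f : ℕ → ℝ}
    (hf : ∀ t : ℕ, |f t| ≤ R + K * t) :
    (Summable fun t => β ^ t * f t) ∧
      |∑' t, β ^ t * f t| ≤ ∑' t : ℕ, β ^ t * (R + K * t) := by
  have hs := summable_pow_mul_linear hβ0 hβ1 R K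
  have hle : ∀ t : ℕ, ‖β ^ t * f t‖ ≤ β ^ t * (R + K * t) := by
    intro t
    rw [norm_mul, Real.norm_of_nonneg (pow_nonneg hβ0.le t)]
    exact mul_le_mul_of_nonneg_left (hf t) (pow_nonneg hβ0.le t)
  exact ⟨hs.of_norm_bounded hle, tsum_of_norm_bounded hs.hasSum hle⟩

/-! ### Convergence and bounds of the accumulated utilities -/

variable (G : MTDGame N M)

lemma exists_utility_bound : ∃ R, 0 ≤ R ∧ (∀ a b s n, |G.U₁ a b s n| ≤ R + |G.q| * n) ∧
    ∀ a b s, |G.U₂ a b s| ≤ R := by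
  let f : Method N M × Fin N × Method N M → ℝ := fun i =>
    |G.R₁ i.2.1 + G.T₁ i.1 i.2.1 i.2.2 - G.P₁ i.2.2| + |G.U₂ i.1 i.2.1 i.2.2|
  have hf : ∀ i, 0 ≤ f i := fun i => by positivity
  have hle : ∀ a b s, f (a, b, s) ≤ ∑ i, f i := fun a b s =>
    single_le_sum (fun i _ => hf i) (mem_univ (a, b, s))
  refine ⟨∑ i, f i, sum_nonneg fun i _ => hf i, fun a b s n => ?_, fun a b s => ?_⟩
  · have h1 : |G.U₁ a b s n| ≤ |G.R₁ b + G.T₁ a b s - G.P₁ s| + |G.q * n| := abs_sub _ _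
    rw [abs_mul, Nat.abs_cast] at h1
    have h2 : |G.R₁ b + G.T₁ a b s - G.P₁ s| ≤ f (a, b, s) :=
      le_add_of_nonneg_right (abs_nonneg _)
    linarith [hle a b s]
  · exact le_trans (le_add_of_nonneg_left (abs_nonneg _)) (hle a b s)

/-- The defender's accumulated utility converges and is bounded, uniformly over plays and
strategies, and so is the attacker's. -/
theorem exists_accumulated_bound (hβ0 : 0 < G.β) (hβ1 : G.β < 1) : ∃ B : ℝ,
    (∀ (ω : ℕ → Method N M) (b : ℕ → Fin N),
      Summable (G.playTerm₁ ω b) ∧ |G.playUtility₁ ω b| ≤ B) ∧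
    (∀ (σ : Strategy N M (Method N M)) (τ : Strategy N M (Fin N)) (s : Method N M),
      (Summable (G.term₁ σ τ s) ∧ |G.Phi₁ σ τ s| ≤ B) ∧
      (Summable (G.term₂ σ τ s) ∧ |G.Phi₂ σ τ s| ≤ B)) := by
  obtain ⟨R, hR, h1, h2⟩ := G.exists_utility_bound
  refine ⟨∑' t : ℕ, G.β ^ t * (R + |G.q| * t), fun ω b => ?_, fun σ τ s => ⟨?_, ?_⟩⟩
  · refine summable_and_abs_tsum_le hβ0 hβ1 fun t => (h1 _ _ _ _).trans ?_
    have : (changes ω t : ℝ) ≤ t := by exact_mod_cast changes_le ω t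
    gcongr
  · refine summable_and_abs_tsum_le hβ0 hβ1 fun t => ?_
    simpa [config] using abs_expectedStep_le (abs_nonneg G.q) h1 σ τ s t []
  · refine summable_and_abs_tsum_le hβ0 hβ1 fun t => ?_
    have h3 : ∀ (a : Method N M) (b : Fin N) (s : Method N M) (n : ℕ),
        |(fun a b s (_ : ℕ) => G.U₂ a b s) a b s n| ≤ R + |G.q| * n := fun a b s n =>
      (h2 a b s).trans (le_add_of_nonneg_right (by positivity))
    simpa [config] using abs_expectedStep_le (abs_nonneg G.q) h3 σ τ s t []

/-- The utility of the first `t` steps after the past `h`, plus the discounted expectation of the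
value `v` of the configuration reached. -/
noncomputable def truncatedValue (v : Method N M × ℕ → ℝ) (σ : Strategy N M (Method N M))
    (τ : Strategy N M (Fin N)) (s : Method N M) (t : ℕ) (h : List (Method N M × Fin N)) : ℝ :=
  ∑ k ∈ range t, G.β ^ k * expectedStep G.U₁ σ τ s k h +
    G.β ^ t * expectedStep (fun _ _ s n => v (s, n)) σ τ s t h

/-! ### Finite-horizon values and optimality -/

variable {G} {v : Method N M × ℕ → ℝ} {σ : Strategy N M (Method N M)} {τ : Strategy N M (Fin N)}
  {s : Method N M}

lemma truncatedValue_zero (h : List (Method N M × Fin N)) :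
    G.truncatedValue v σ τ s 0 h = v (config s h) := by
  simp only [truncatedValue, range_zero, sum_empty, pow_zero, one_mul, zero_add, expectedStep]
  rw [sum_sum_of_const_right (τ (s, h)).2, ← sum_mul, (σ (s, h)).2.2, one_mul]

/-- Conditioning on the first pair of actions; this recursion drives the inductions on the horizon.
-/
lemma truncatedValue_succ (t : ℕ) (h : List (Method N M × Fin N)) :
    G.truncatedValue v σ τ s (t + 1) h = ∑ a, ∑ b, (σ (s, h)).1 a * (τ (s, h)).1 b *
      (G.U₁ a b (config s h).1 (config s h).2 +
        G.β * G.truncatedValue v σ τ s t ((a, b) :: h)) := by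
  simp only [truncatedValue, sum_range_succ', expectedStep, pow_zero, one_mul, mul_add,
    sum_add_distrib, mul_sum]
  have h1 : ∀ (w : Method N M → Fin N → ℝ) (g : Method N M → Fin N → ℕ → ℝ),
      ∑ k ∈ range t, ∑ a, ∑ b, G.β ^ (k + 1) * (w a b * g a b k) =
        ∑ a, ∑ b, ∑ k ∈ range t, w a b * (G.β * (G.β ^ k * g a b k)) := by
    intro w g
    rw [sum_comm]
    refine sum_congr rfl fun a _ => ?_
    rw [sum_comm]
    refine sum_congr rfl fun b _ => sum_congr rfl fun k _ => ?_
    ring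
  rw [h1]
  have h2 : ∀ (w g : Method N M → Fin N → ℝ),
      ∑ a, ∑ b, G.β ^ (t + 1) * (w a b * g a b) =
        ∑ a, ∑ b, w a b * (G.β * (G.β ^ t * g a b)) := by
    intro w g
    refine sum_congr rfl fun a _ => sum_congr rfl fun b _ => ?_
    ring
  rw [h2]
  ring

/-- The value at the horizon grows at most linearly in `t`, so the weight `β ^ t` makes it vanish,
whatever the strategies. -/
lemma tendsto_truncatedValue (hβ0 : 0 < G.β) (hβ1 : G.β < 1) {R K : ℝ} (hK : 0 ≤ K)
    (hv : ∀ c, |v c| ≤ R + K * c.2) :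
    Tendsto (fun t => G.truncatedValue v σ τ s t []) atTop (𝓝 (G.Phi₁ σ τ s)) := by
  obtain ⟨B, -, hB⟩ := G.exists_accumulated_bound hβ0 hβ1
  have h1 := (hB σ τ s).1.1.hasSum.tendsto_sum_nat
  have h2 : Tendsto (fun t => G.β ^ t * expectedStep (fun _ _ s n => v (s, n)) σ τ s t [])
      atTop (𝓝 0) := by
    refine (summable_and_abs_tsum_le (R := R) (K := K) hβ0 hβ1 fun t => ?_).1.tendsto_atTop_zero
    simpa [config] using abs_expectedStep_le hK (fun _ _ s n => hv (s, n)) σ τ s t []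
  have h3 := h1.add h2
  rw [add_zero] at h3
  exact h3

/-- The value of the action `a` of the defender in the configuration `c` if the attacker uses `y`
and the configurations have the values `v`. -/
noncomputable def actionValue (G : MTDGame N M) (y : Fin N → ℝ) (v : Method N M × ℕ → ℝ)
    (c : Method N M × ℕ) (a : Method N M) : ℝ :=
  ∑ b, y b * (G.U₁ a b c.1 c.2 + G.β * v (nextConfig a c))

/-- Even after a history-dependent deviation, each step averages action values, none of which
exceeds `v`. -/
lemma truncatedValue_le (hβ0 : 0 < G.β) {H : StationaryStrategy N M (Fin N)}
    (hv : ∀ c a, G.actionValue (H c).1 v c a ≤ v c) (t : ℕ) (h : List (Method N M × Fin N)) :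
    G.truncatedValue v σ H.toStrategy s t h ≤ v (config s h) := by
  induction t generalizing h with
  | zero => exact (truncatedValue_zero h).le
  | succ t ih =>
    rw [truncatedValue_succ]
    refine (sum_sum_le_sum_sum (σ (s, h)).2 (H.toStrategy (s, h)).2 fun a b =>
      add_le_add_right (mul_le_mul_of_nonneg_left (ih _) hβ0.le) _).trans ?_
    rw [sum_sum_mul_mul]
    exact sum_mul_le_of_le (σ (s, h)).2 fun a => hv _ a

lemma truncatedValue_eq {E : StationaryStrategy N M (Method N M)}
    {H : StationaryStrategy N M (Fin N)}
    (hv : ∀ c, v c = ∑ a, (E c).1 a * G.actionValue (H c).1 v c a) (t : ℕ)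
    (h : List (Method N M × Fin N)) :
    G.truncatedValue v E.toStrategy H.toStrategy s t h = v (config s h) := by
  induction t generalizing h with
  | zero => exact truncatedValue_zero h
  | succ t ih =>
    simp only [truncatedValue_succ, ih]
    rw [sum_sum_mul_mul, hv]
    rfl

/-- The attacker's expected utility after `t` steps from the configuration `c`, if both players
use stationary strategies. -/
noncomputable def attackerStep (G : MTDGame N M) (E : StationaryStrategy N M (Method N M))
    (H : StationaryStrategy N M (Fin N)) : ℕ → Method N M × ℕ → ℝ
  | 0, c => ∑ b, (H c).1 b * ∑ a, (E c).1 a * G.U₂ a b c.1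
  | t + 1, c => ∑ a, (E c).1 a * attackerStep G E H t (nextConfig a c)

lemma sum_sum_mul_mul_comm {A B : Type*} [Fintype A] [Fintype B] (x : A → ℝ) (y : B → ℝ)
    (g : A → B → ℝ) : ∑ a, ∑ b, x a * y b * g a b = ∑ b, y b * ∑ a, x a * g a b := by
  rw [sum_comm]
  refine sum_congr rfl fun b _ => ?_
  rw [mul_sum]
  exact sum_congr rfl fun a _ => by ring

lemma expectedStep_eq_attackerStep {E : StationaryStrategy N M (Method N M)}
    {H : StationaryStrategy N M (Fin N)} (t : ℕ) (h : List (Method N M × Fin N)) :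
    expectedStep (fun a b s _ => G.U₂ a b s) E.toStrategy H.toStrategy s t h =
      G.attackerStep E H t (config s h) := by
  induction t generalizing h with
  | zero => exact sum_sum_mul_mul_comm _ _ _
  | succ t ih =>
    simp only [expectedStep, ih, config_cons]
    exact sum_sum_of_const_right (H.toStrategy (s, h)).2 _

/-- The next configuration depends on the defender's action alone, so a deviation of the attacker
leaves the law of the configuration after `t` steps unchanged. It only alters the action played
there, where that of `H` is already optimal. -/
lemma expectedStep_le_attackerStep {E : StationaryStrategy N M (Method N M)}
    {H : StationaryStrategy N M (Fin N)}
    (hopt : ∀ c b, ∑ a, (E c).1 a * G.U₂ a b c.1 ≤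
      ∑ b', (H c).1 b' * ∑ a, (E c).1 a * G.U₂ a b' c.1) (t : ℕ)
    (h : List (Method N M × Fin N)) :
    expectedStep (fun a b s _ => G.U₂ a b s) E.toStrategy τ s t h ≤
      G.attackerStep E H t (config s h) := by
  induction t generalizing h with
  | zero =>
    rw [expectedStep, sum_sum_mul_mul_comm]
    exact sum_mul_le_of_le (τ (s, h)).2 fun b => hopt _ b
  | succ t ih =>
    rw [expectedStep]
    refine (sum_sum_le_sum_sum (E.toStrategy (s, h)).2 (τ (s, h)).2 fun a b => ih _).trans_eq ?_
    exact sum_sum_of_const_right (τ (s, h)).2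
      fun a => G.attackerStep E H t (nextConfig a (config s h))

/-- Stationary strategies with values satisfying the optimality equation of the defender, and
with myopically optimal actions of the attacker, form an equilibrium. -/
theorem isEquilibrium_of_optimal (hβ0 : 0 < G.β) (hβ1 : G.β < 1)
    {E : StationaryStrategy N M (Method N M)} {H : StationaryStrategy N M (Fin N)} {R K : ℝ}
    (hK : 0 ≤ K) (hvb : ∀ c, |v c| ≤ R + K * c.2)
    (hv : ∀ c, v c = ∑ a, (E c).1 a * G.actionValue (H c).1 v c a)
    (hmax : ∀ c a, G.actionValue (H c).1 v c a ≤ v c)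
    (hopt : ∀ c b, ∑ a, (E c).1 a * G.U₂ a b c.1 ≤
      ∑ b', (H c).1 b' * ∑ a, (E c).1 a * G.U₂ a b' c.1) :
    G.IsEquilibrium E.toStrategy H.toStrategy := by
  intro s
  refine ⟨fun σ' => ?_, fun τ' => ?_⟩
  · have h1 : G.Phi₁ E.toStrategy H.toStrategy s = v (config s []) :=
      tendsto_nhds_unique (tendsto_truncatedValue hβ0 hβ1 hK hvb)
        (tendsto_const_nhds.congr fun t => (truncatedValue_eq hv t []).symm)
    rw [h1]
    exact le_of_tendsto' (tendsto_truncatedValue hβ0 hβ1 hK hvb)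
      fun t => truncatedValue_le hβ0 hmax t []
  · obtain ⟨B, -, hB⟩ := G.exists_accumulated_bound hβ0 hβ1
    refine (hB _ _ s).2.1.tsum_le_tsum (fun t => ?_) (hB _ _ s).2.1
    refine mul_le_mul_of_nonneg_left ?_ (pow_nonneg hβ0.le t)
    rw [expectedStep_eq_attackerStep (H := H)]
    exact expectedStep_le_attackerStep hopt t []

variable (G)

/-- The stochastic game has an equilibrium in stationary strategies. -/
theorem exists_stationary_equilibrium (hβ0 : 0 < G.β) (hβ1 : G.β < 1) :
    ∃ (E : StationaryStrategy N M (Method N M)) (H : StationaryStrategy N M (Fin N)),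
      G.IsEquilibrium E.toStrategy H.toStrategy := by
  rcases isEmpty_or_nonempty (Method N M) with hM | hM
  · exact ⟨fun c => isEmptyElim c.1, fun c => isEmptyElim c.1, fun s => isEmptyElim s⟩
  have hN : Nonempty (Fin N) := hM.map Prod.fst
  obtain ⟨R, hR, hU, -⟩ := G.exists_utility_bound
  have hβ : 0 < 1 - G.β := by linarith
  -- `K` and `S` solve `|q| + β K = K` and `R + β K + β S = S`, so that `R + |q| n + β (S + K (n +
  -- 1)) = S + K n`: the value update preserves the bound.
  set K := |G.q| / (1 - G.β) with hKdef
  have hK : 0 ≤ K := by positivity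
  have hKq : |G.q| + G.β * K = K := by
    rw [hKdef]
    field_simp
    ring
  set S := (R + G.β * K) / (1 - G.β) with hSdef
  have hS : 0 ≤ S := by positivity
  have hSR : R + G.β * K + G.β * S = S := by
    rw [hSdef]
    field_simp
    ring
  obtain ⟨z, hz, hv, hx, hy⟩ := Equilibrium.exists_isAdmissible_fixedPoint
    (C := Method N M × ℕ) (A := Method N M) (B := Fin N) (L := fun c => S + K * c.2)
    (fun c => by positivity)
    (p := fun z c a => G.actionValue (z.2.1 c) z.2.2 c a)
    (r := fun z c b => ∑ a, z.1 c a * G.U₂ a b c.1)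
    (T := fun z c => ∑ a, z.1 c a * G.actionValue (z.2.1 c) z.2.2 c a)
    (by unfold actionValue; fun_prop)
    (by fun_prop)
    (by unfold actionValue; fun_prop)
    (by
      intro z hz c
      refine abs_sum_mul_le_of_abs_le (hz.fst_mem c) fun a =>
        abs_sum_mul_le_of_abs_le (hz.snd_mem c) fun b => (abs_add_le _ _).trans ?_
      rw [abs_mul, abs_of_pos hβ0]
      have h1 := hU a b c.1 c.2
      have h2 : |z.2.2 (nextConfig a c)| ≤ S + K * (c.2 + 1) := by
        refine (hz.abs_le _).trans ?_
        have : ((nextConfig a c).2 : ℝ) ≤ c.2 + 1 := by exact_mod_cast nextConfig_snd_le a c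
        gcongr
      have h3 := mul_le_mul_of_nonneg_left h2 hβ0.le
      have h4 : K * (c.2 : ℝ) = |G.q| * c.2 + G.β * K * c.2 := by
        rw [← add_mul, hKq]
      linarith)
  refine ⟨fun c => ⟨z.1 c, hz.fst_mem c⟩, fun c => ⟨z.2.1 c, hz.snd_mem c⟩,
    isEquilibrium_of_optimal hβ0 hβ1 hK hz.abs_le hv (fun c a => ?_) hy⟩
  rw [hv c]
  exact hx c a

end MTDGame

/-- With the linear cost, (1) the defender's accumulated utility converges and is bounded,
uniformly over all plays and over all strategies (and so is the attacker's), (2) the bimatrix game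
over the pure stationary strategies has a mixed Nash equilibrium, and (3) the stochastic game
has a Nash equilibrium in stationary strategies. -/
theorem lemma1 {N M : ℕ} (G : MTDGame N M) (hβ0 : 0 < G.β) (hβ1 : G.β < 1) :
    (∃ B : ℝ,
      (∀ (ω : ℕ → Method N M) (b : ℕ → Fin N),
        Summable (G.playTerm₁ ω b) ∧ |G.playUtility₁ ω b| ≤ B) ∧
      (∀ (σ : MTDGame.Strategy N M (Method N M)) (τ : MTDGame.Strategy N M (Fin N))
        (s : Method N M),
        (Summable (G.term₁ σ τ s) ∧ |G.Phi₁ σ τ s| ≤ B) ∧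
        (Summable (G.term₂ σ τ s) ∧ |G.Phi₂ σ τ s| ≤ B))) ∧
    (∃ x y, IsBimatrixEquilibrium G.X G.Y x y) ∧
    (∃ (E : MTDGame.StationaryStrategy N M (Method N M))
        (H : MTDGame.StationaryStrategy N M (Fin N)),
      G.IsEquilibrium E.toStrategy H.toStrategy) := by
  -- Both strategy sets are inhabited even if there are no methods.
  have hf : Nonempty (Method N M → Method N M) := ⟨id⟩
  have hg : Nonempty (Method N M → Fin N) := ⟨Prod.fst⟩
  exact ⟨G.exists_accumulated_bound hβ0 hβ1, Equilibrium.exists_isBimatrixEquilibrium G.X G.Y,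
    G.exists_stationary_equilibrium hβ0 hβ1⟩
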